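/- There is an absolute constant $c>0$ such that the following holds for all integers $n\ge 1$ and $k\ge 1$ and every discrete probability distribution $\pi$ on $\mathbb{R}_{\ge 0}^n$ (the distribution of the valuation vector $v=(v_1,\dots,v_n)$ of $n$ buyers; $k$ is the number of available services, and each buyer wants at most one). There exists an enhanced sequential posted price mechanism for the instance $(n,\pi,k)$ whose expected revenue is at least $\frac{c}{n}\cdot \mathrm{OPT}$, where $\mathrm{OPT}\in[0,\infty]$ is the supremum of the expected revenues of all ex-post IC, ex-post IR mechanisms for $(n,\pi,k)$. Here $\pi_i$ denotes the $i$-th marginal of $\pi$, and $\mathrm{supp}$ denotes the set of points of positive probability. A deterministic direct revelation mechanism is a map from $\prod_i \mathrm{supp}(\pi_i)$ to the outcomes $(x,p)\in\{0,1\}^n\times\mathbb{R}_{\ge 0}^n$ with $\sum_i x_i\le k$ ($x$ is the allocation, $p$ the payments). A mechanism is a probability distribution over deterministic direct revelation mechanisms; write $x_i(s)$ and $p_i(s)$ for the expected allocation and the expected payment of buyer $i$ at the report vector $s$. Its expected revenue is $\mathbf{E}_{v\sim\pi}\left[\sum_i p_i(v)\right]\in[0,\infty]$. It is ex-post IC if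 $x_i(v)v_i-p_i(v)\ge x_i(s_i,v_{-i})v_i-p_i(s_i,v_{-i})$ for all $i$, all $s_i\in\mathrm{supp}(\pi_i)$ and all $v\in\mathrm{supp}(\pi)$. It is ex-post IR if $x_i(v)v_i-p_i(v)\ge 0$ for all $i$ and all $v\in\mathrm{supp}(\pi)$. An enhanced sequential posted price mechanism is a mechanism implemented by a procedure of the following kind. It iteratively selects a buyer $i$ that has not been selected before, and either proposes the service to $i$ at a price $p_i\ge 0$, which is possible only while fewer than $k$ buyers have accepted, or asks $i$ for his valuation. If offered the service, buyer $i$ accepts iff $p_i\le v_i$; he then gets the service and pays $p_i$, and otherwise he neither gets the service nor pays. If asked, he answers truthfully, pays nothing and does not get the service. The choices of the procedure may be randomized and may depend on all earlier replies. -/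

import Mathlib

open MeasureTheory
open scoped ENNReal NNReal

noncomputable section

namespace Auction

/-- An outcome for `n` buyers and supply `k`: a `0`-`1` allocation vector that serves at most `k`
buyers, together with a vector of nonnegative payments. -/
abbrev Outcome (n k : ℕ) : Type :=
  {o : (Fin n → Bool) × (Fin n → ℝ≥0) // (Finset.univ.filter fun i => o.1 i = true).card ≤ k}

/-- Strategy profiles of a direct revelation mechanism: buyer `i` reports an element of the support
of the `i`-th marginal of the valuation distribution `π`. -/
abbrev Profile {n : ℕ} (π : PMF (Fin n → ℝ≥0)) : Type :=
  (i : Fin n) → (π.map fun v => v i).support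

/-- Deterministic direct revelation mechanisms. -/
abbrev DetMechanism {n : ℕ} (π : PMF (Fin n → ℝ≥0)) (k : ℕ) : Type :=
  Profile π → Outcome n k

/-- Randomized direct revelation mechanisms: probability distributions over deterministic ones.
The σ-algebra on deterministic mechanisms is the product one, generated by the evaluations at the
strategy profiles. -/
abbrev Mechanism {n : ℕ} (π : PMF (Fin n → ℝ≥0)) (k : ℕ) : Type :=
  ProbabilityMeasure (DetMechanism π k)

section

variable {n k : ℕ} {π : PMF (Fin n → ℝ≥0)}

/-- The profile in which all buyers report their valuations truthfully. -/
def truthful (v : π.support) : Profile π :=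
  fun i => ⟨v.1 i, (PMF.mem_support_map_iff _ _ _).2 ⟨v.1, v.2, rfl⟩⟩

/-- Expected allocation of buyer `i` at the profile `s`. -/
def expAlloc (M : Mechanism π k) (i : Fin n) (s : Profile π) : ℝ≥0∞ :=
  ∫⁻ f, (if (f s).1.1 i = true then 1 else 0) ∂(M : Measure (DetMechanism π k))

/-- Expected payment of buyer `i` at the profile `s`. -/
def expPay (M : Mechanism π k) (i : Fin n) (s : Profile π) : ℝ≥0∞ :=
  ∫⁻ f, ((f s).1.2 i : ℝ≥0∞) ∂(M : Measure (DetMechanism π k))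

/-- Expected utility of buyer `i` with valuation `w` at the profile `s`; it is `⊥` exactly if
the expected payment is infinite. -/
def expUtility (M : Mechanism π k) (i : Fin n) (w : ℝ≥0) (s : Profile π) : EReal :=
  ((expAlloc M i s * (w : ℝ≥0∞) : ℝ≥0∞) : EReal) - ((expPay M i s : ℝ≥0∞) : EReal)

/-- Ex-post incentive compatibility. -/
def IsExPostIC (M : Mechanism π k) : Prop :=
  ∀ (i : Fin n) (r : (π.map fun v => v i).support) (v : π.support),
    expUtility M i (v.1 i) (Function.update (truthful v) i r) ≤
      expUtility M i (v.1 i) (truthful v)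

/-- Ex-post individual rationality. -/
def IsExPostIR (M : Mechanism π k) : Prop :=
  ∀ (i : Fin n) (v : π.support), 0 ≤ expUtility M i (v.1 i) (truthful v)

/-- Expected revenue when the valuations are drawn from `π` and are reported truthfully. -/
def revenue (M : Mechanism π k) : ℝ≥0∞ :=
  ∑' v : π.support, π v.1 * ∑ i, expPay M i (truthful v)

end

/-- Optimal expected revenue over all ex-post IC, ex-post IR mechanisms. -/
def optRevenue {n : ℕ} (π : PMF (Fin n → ℝ≥0)) (k : ℕ) : ℝ≥0∞ :=
  ⨆ (M : Mechanism π k) (_ : IsExPostIC M) (_ : IsExPostIR M), revenue M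

/-- Deterministic adaptive procedures of an enhanced sequential posted price mechanism, where `S`
is the set of buyers that have not been selected yet and `k` is the remaining supply. In each
iteration the procedure selects a buyer `i ∈ S`, and either proposes the service at a price `p`
(possible only while there is supply left) or asks `i` for his valuation; how it continues depends
on the reply. Stopping is the same as asking all remaining buyers and ignoring their replies. -/
inductive Procedure (n : ℕ) : Finset (Fin n) → ℕ → Type
  | halt {S : Finset (Fin n)} {k : ℕ} : Procedure n S k
  | offer {S : Finset (Fin n)} {k : ℕ} (i : Fin n) (hi : i ∈ S) (p : ℝ≥0)
      (accepted : Procedure n (S.erase i) k) (rejected : Procedure n (S.erase i) (k + 1)) :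
      Procedure n S (k + 1)
  | ask {S : Finset (Fin n)} {k : ℕ} (i : Fin n) (hi : i ∈ S)
      (answered : ℝ≥0 → Procedure n (S.erase i) k) : Procedure n S k

namespace Procedure

variable {n : ℕ}

/-- Allocation and payments that result when the buyers have valuations `v`: a buyer accepts a
price iff it does not exceed his valuation, and truthfully answers when asked for his valuation. -/
def run (v : Fin n → ℝ≥0) :
    {S : Finset (Fin n)} → {k : ℕ} → Procedure n S k → (Fin n → Bool) × (Fin n → ℝ≥0)
  | _, _, halt => (fun _ => false, fun _ => 0)
  | _, _, offer i _ p accepted rejected =>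
      if p ≤ v i then
        (Function.update (run v accepted).1 i true, Function.update (run v accepted).2 i p)
      else run v rejected
  | _, _, ask i _ answered => run v (answered (v i))

theorem card_run_le (v : Fin n → ℝ≥0) {S : Finset (Fin n)} {k : ℕ} (T : Procedure n S k) :
    (Finset.univ.filter fun i => (run v T).1 i = true).card ≤ k := by
  induction T with
  | halt => simp [run]
  | offer i hi p a r iha ihr =>
    rw [run]
    split_ifs with h
    · refine le_trans (Finset.card_le_card (t := insert i
        (Finset.univ.filter fun j => (run v a).1 j = true)) ?_)
        ((Finset.card_insert_le _ _).trans (Nat.succ_le_succ iha))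
      intro j hj
      by_cases hji : j = i
      · simp [hji]
      · simpa [hji, Function.update_of_ne hji] using hj
    · exact ihr
  | ask i hi c ih =>
    rw [run]
    exact ih (v i)

/-- The deterministic direct revelation mechanism induced by a procedure that starts with all
buyers unselected and with supply `k`. -/
def toMechanism (π : PMF (Fin n → ℝ≥0)) {k : ℕ} (T : Procedure n Finset.univ k) :
    DetMechanism π k :=
  fun s => ⟨run (fun i => (s i).1) T, card_run_le _ T⟩

end Procedure

/-- Enhanced sequential posted price mechanisms: those implemented by a randomly drawn procedure. -/
def IsEnhancedSPP {n k : ℕ} {π : PMF (Fin n → ℝ≥0)} (M : Mechanism π k) : Prop :=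
  ∃ (Ω : Type) (_ : MeasurableSpace Ω) (P : ProbabilityMeasure Ω)
    (T : Ω → Procedure n Finset.univ k)
    (hT : Measurable fun ω => (T ω).toMechanism π),
    M = P.map hT.aemeasurable

end Auction

end

/-! Fix a buyer and the valuations of the others. Along this line of type vectors, an ex-post IC and
IR mechanism is a single-buyer mechanism, so by Myerson's argument it earns at most the best posted
price (`tsum_mul_pay_le_iSup_price`). That price may depend on the others' valuations, so an
enhanced procedure can charge it: ask everybody else, then make one offer
(`Procedure.condPriceRevenue_le_iSup`). Summing over the buyers, OPT is at most `n` times the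
supremum of the revenues of deterministic procedures; the supply limit is not needed for this bound.

The supremum need not be attained and may be infinite. A geometric mixture of procedures earns a
quarter of it in either case (`exists_isEnhancedSPP_iSup_le`), whence `c = 1/4`. -/

namespace Auction

/-! ### Single-buyer mechanisms and posted prices -/

/-- The revenue bound for single-buyer incentive compatible mechanisms on a finite set of types,
relative to a base allocation `x₀` and a base payment `p₀`. -/
theorem sum_mul_pay_sub_le (q x p : ℝ≥0 → ℝ) (S : ℝ) (hS0 : 0 ≤ S) (F : Finset ℝ≥0)
    (hq : ∀ w ∈ F, 0 ≤ q w) (hx : ∀ w ∈ F, x w ≤ 1)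
    (hic : ∀ w ∈ F, ∀ w' ∈ F, x w' * w - p w' ≤ x w * w - p w)
    (hS : ∀ t ∈ F, (t : ℝ) * ∑ w ∈ F with t ≤ w, q w ≤ S) (x₀ p₀ : ℝ) (hx₀ : x₀ ≤ 1)
    (hbase : ∀ w ∈ F, x₀ ≤ x w ∧ p w - p₀ ≤ w * (x w - x₀)) :
    ∑ w ∈ F, q w * (p w - p₀) ≤ S * (1 - x₀) := by
  induction F using Finset.induction_on_min generalizing x₀ p₀ with
  | empty => simpa using mul_nonneg hS0 (sub_nonneg.2 hx₀)
  | insert a s ha ih =>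
    have has : a ∉ s := fun h => lt_irrefl _ (ha a h)
    have hmem : a ∈ insert a s := Finset.mem_insert_self _ _
    have hsub : ∀ {w}, w ∈ s → w ∈ insert a s := fun h => Finset.mem_insert_of_mem h
    -- The least type `a` is removed, and its allocation and payment become the new base.
    have key := ih (fun w hw => hq w (hsub hw)) (fun w hw => hx w (hsub hw))
      (fun w hw w' hw' => hic w (hsub hw) w' (hsub hw'))
      (fun t ht => by
        have h := hS t (hsub ht)
        rwa [Finset.filter_insert, if_neg (not_le.2 (ha t ht))] at h)
      (x a) (p a) (hx a hmem)
      (fun w hw => by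
        have h1 := hic w (hsub hw) a hmem
        have h2 := hic a hmem w (hsub hw)
        have h3 : (a : ℝ) < w := ha w hw
        constructor
        · by_contra hlt
          push Not at hlt
          nlinarith [mul_pos (sub_pos.2 hlt) (sub_pos.2 h3)]
        · linarith)
    have htot := hS a hmem
    have hfil : (insert a s).filter (fun w => a ≤ w) = insert a s := by
      refine Finset.filter_true_of_mem fun w hw => ?_
      rcases Finset.mem_insert.1 hw with rfl | h
      exacts [le_rfl, (ha w h).le]
    rw [hfil] at htot
    obtain ⟨hb1, hb2⟩ := hbase a hmem
    have hQ : 0 ≤ ∑ w ∈ insert a s, q w := Finset.sum_nonneg hq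
    have hsplit : ∑ w ∈ insert a s, q w * (p w - p₀) =
        (∑ w ∈ insert a s, q w) * (p a - p₀) + ∑ w ∈ s, q w * (p w - p a) := by
      have : ∑ w ∈ s, q w * (p w - p a) = ∑ w ∈ insert a s, q w * (p w - p a) := by
        rw [Finset.sum_insert has]; ring
      rw [this, Finset.sum_mul, ← Finset.sum_add_distrib]
      exact Finset.sum_congr rfl fun w _ => by ring
    rw [hsplit]
    have h1 := mul_le_mul_of_nonneg_left hb2 hQ
    have h2 := mul_le_mul_of_nonneg_right htot (sub_nonneg.2 hb1)
    -- With `Q` the total weight, `Q * (p a - p₀) ≤ Q * a * (x a - x₀) ≤ S * (x a - x₀)`; adding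
    -- `key` telescopes to `S * (1 - x₀)`.
    nlinarith

/-- A single-buyer mechanism that is incentive compatible and individually rational on the types
of positive weight extracts at most the revenue of the best posted price. -/
theorem tsum_mul_pay_le_iSup_price (q x p : ℝ≥0 → ℝ≥0∞) (hq : ∀ w, q w ≠ ⊤)
    (hx : ∀ w, x w ≤ 1) (hir : ∀ w, q w ≠ 0 → p w ≤ x w * w)
    (hic : ∀ w w', q w ≠ 0 → q w' ≠ 0 →
      (x w').toReal * w - (p w').toReal ≤ (x w).toReal * w - (p w).toReal) :
    ∑' w, q w * p w ≤ ⨆ t : ℝ≥0, (t : ℝ≥0∞) * ∑' w, if t ≤ w then q w else 0 := by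
  set S := ⨆ t : ℝ≥0, (t : ℝ≥0∞) * ∑' w, if t ≤ w then q w else 0 with hSdef
  by_cases hS : S = ⊤
  · rw [hS]; exact le_top
  rw [ENNReal.tsum_eq_iSup_sum]
  refine iSup_le fun F => ?_
  have hxtop : ∀ w, x w ≠ ⊤ := fun w => ne_top_of_le_ne_top ENNReal.one_ne_top (hx w)
  have hptop : ∀ w, q w ≠ 0 → p w ≠ ⊤ := fun w hw =>
    ne_top_of_le_ne_top (ENNReal.mul_ne_top (hxtop w) ENNReal.coe_ne_top) (hir w hw)
  have hF : ∑ w ∈ F, q w * p w = ∑ w ∈ F with q w ≠ 0, q w * p w := by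
    refine (Finset.sum_subset (Finset.filter_subset _ _) fun w hw h => ?_).symm
    have : q w = 0 := by simpa [hw] using h
    simp [this]
  have hmem : ∀ {w}, w ∈ F.filter (fun w => q w ≠ 0) → q w ≠ 0 := fun h =>
    (Finset.mem_filter.1 h).2
  have key := sum_mul_pay_sub_le (fun w => (q w).toReal) (fun w => (x w).toReal)
    (fun w => (p w).toReal) S.toReal ENNReal.toReal_nonneg (F.filter fun w => q w ≠ 0)
    (fun w _ => ENNReal.toReal_nonneg)
    (fun w _ => by simpa using ENNReal.toReal_mono ENNReal.one_ne_top (hx w))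
    (fun w hw w' hw' => hic w w' (hmem hw) (hmem hw'))
    (fun t _ => by
      have h : (t : ℝ≥0∞) * ∑ w ∈ (F.filter fun w => q w ≠ 0) with t ≤ w, q w ≤ S := by
        refine le_trans ?_ (le_iSup (fun t : ℝ≥0 =>
          (t : ℝ≥0∞) * ∑' w, if t ≤ w then q w else 0) t)
        rw [Finset.sum_filter]
        gcongr
        exact ENNReal.sum_le_tsum _
      have h' := ENNReal.toReal_mono hS h
      rwa [ENNReal.toReal_mul, ENNReal.toReal_sum fun w _ => hq w, ENNReal.coe_toReal] at h')
    -- The initial base is the outside option: no service and no payment. For it, the base condition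
    -- is individual rationality.
    0 0 zero_le_one
    (fun w hw => ⟨ENNReal.toReal_nonneg, by
      have h := ENNReal.toReal_mono (ENNReal.mul_ne_top (hxtop w) ENNReal.coe_ne_top)
        (hir w (hmem hw))
      rw [ENNReal.toReal_mul, ENNReal.coe_toReal] at h
      simpa [mul_comm] using h⟩)
  have hne : ∀ w ∈ F.filter (fun w => q w ≠ 0), q w * p w ≠ ⊤ := fun w hw =>
    ENNReal.mul_ne_top (hq w) (hptop w (hmem hw))
  rw [hF, ← ENNReal.toReal_le_toReal (ENNReal.sum_ne_top.2 hne) hS, ENNReal.toReal_sum hne]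
  simpa [ENNReal.toReal_mul] using key

/-- A sum of suprema is attained by choice functions. -/
theorem tsum_iSup_le_iSup_tsum {α β : Type*} (g : α → β → ℝ≥0∞) :
    ∑' a, ⨆ b, g a b ≤ ⨆ P : α → β, ∑' a, g a (P a) := by
  classical
  rw [ENNReal.tsum_eq_iSup_sum]
  refine iSup_le fun F => ?_
  have h1 : ∀ a, ⨆ b, g a b ≤ ⨆ P : α → β, g a (P a) := fun a => by
    refine iSup_le fun b => le_iSup_of_le (fun _ => b) le_rfl
  refine (Finset.sum_le_sum fun a _ => h1 a).trans ?_
  rw [ENNReal.finsetSum_iSup]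
  · exact iSup_mono fun P => ENNReal.sum_le_tsum _
  -- Finite sums commute with directed suprema; choosing the better of `P a` and `Q a` at each `a`
  -- shows directedness.
  · intro P Q
    refine ⟨fun a => if g a (P a) ≤ g a (Q a) then Q a else P a, fun a => ?_⟩
    by_cases h : g a (P a) ≤ g a (Q a)
    · simp [h]
    · simp [h, (not_le.1 h).le]

/-! ### Upper bound on the optimal revenue -/

section

variable {n k : ℕ} {π : PMF (Fin n → ℝ≥0)}

theorem expAlloc_le_one (M : Mechanism π k) (i : Fin n) (s : Profile π) :
    expAlloc M i s ≤ 1 := by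
  calc expAlloc M i s ≤ ∫⁻ _, 1 ∂(M : Measure (DetMechanism π k)) := by
        refine lintegral_mono fun f => ?_
        dsimp only
        split_ifs <;> simp
    _ = 1 := by simp

theorem expAlloc_mul_ne_top (M : Mechanism π k) (i : Fin n) (s : Profile π) (w : ℝ≥0) :
    expAlloc M i s * w ≠ ⊤ :=
  ENNReal.mul_ne_top (ne_top_of_le_ne_top ENNReal.one_ne_top (expAlloc_le_one M i s))
    ENNReal.coe_ne_top

theorem IsExPostIR.expPay_le {M : Mechanism π k} (h : IsExPostIR M) (i : Fin n)
    (v : π.support) : expPay M i (truthful v) ≤ expAlloc M i (truthful v) * (v.1 i : ℝ≥0∞) := by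
  have h0 := h i v
  unfold expUtility at h0
  by_contra hlt
  push Not at hlt
  have hlt' := EReal.coe_ennreal_lt_coe_ennreal_iff.2 hlt
  exact absurd h0 (not_le.2 (EReal.sub_neg
    (Or.inl (EReal.coe_ennreal_eq_top_iff.not.2 (expAlloc_mul_ne_top M i _ _)))
    (Or.inl (EReal.coe_ennreal_ne_bot _)) |>.2 hlt'))

theorem IsExPostIR.expPay_ne_top {M : Mechanism π k} (h : IsExPostIR M) (i : Fin n)
    (v : π.support) : expPay M i (truthful v) ≠ ⊤ :=
  ne_top_of_le_ne_top (expAlloc_mul_ne_top M i _ _) (h.expPay_le i v)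

theorem expUtility_eq_coe (M : Mechanism π k) (i : Fin n) (w : ℝ≥0) (s : Profile π)
    (h : expPay M i s ≠ ⊤) :
    expUtility M i w s = (((expAlloc M i s).toReal * w - (expPay M i s).toReal : ℝ) : EReal) := by
  unfold expUtility
  rw [← EReal.coe_toReal (x := ((expAlloc M i s * (w : ℝ≥0∞) : ℝ≥0∞) : EReal))
      (EReal.coe_ennreal_eq_top_iff.not.2 (expAlloc_mul_ne_top M i s w)) (EReal.coe_ennreal_ne_bot _),
    ← EReal.coe_toReal (x := ((expPay M i s : ℝ≥0∞) : EReal)) (by simpa using h)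
      (EReal.coe_ennreal_ne_bot _), ← EReal.coe_sub]
  rw [EReal.toReal_coe_ennreal, EReal.toReal_coe_ennreal, ENNReal.toReal_mul,
    ENNReal.coe_toReal]

/-- A misreport that leads to another point of the support yields a truthful profile there, so IR
controls its payment and IC becomes an inequality between real numbers. -/
theorem update_truthful (v v' : π.support) (i : Fin n) (h : ∀ j, j ≠ i → v.1 j = v'.1 j) :
    Function.update (truthful v) i (truthful v' i) = truthful v' := by
  funext j
  by_cases hj : j = i
  · subst hj; simp
  · rw [Function.update_of_ne hj]
    exact Subtype.ext (h j hj)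

/-- The valuation vector with `i`-th entry `w` and the other entries given by `u`. -/
abbrev joinAt (i : Fin n) (w : ℝ≥0) (u : {j // j ≠ i} → ℝ≥0) : Fin n → ℝ≥0 :=
  (Equiv.funSplitAt i ℝ≥0).symm (w, u)

theorem joinAt_self (i : Fin n) (w : ℝ≥0) (u : {j // j ≠ i} → ℝ≥0) : joinAt i w u i = w := by
  simp [joinAt, Equiv.funSplitAt, Equiv.piSplitAt]

theorem joinAt_of_ne (i : Fin n) (w : ℝ≥0) (u : {j // j ≠ i} → ℝ≥0) (j : Fin n) (hj : j ≠ i) :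
    joinAt i w u j = u ⟨j, hj⟩ := by
  simp [joinAt, Equiv.funSplitAt, Equiv.piSplitAt, hj]

theorem tsum_joinAt (i : Fin n) (f : (Fin n → ℝ≥0) → ℝ≥0∞) :
    ∑' v, f v = ∑' u, ∑' w, f (joinAt i w u) := by
  rw [← (Equiv.funSplitAt i ℝ≥0).symm.tsum_eq f, ENNReal.tsum_prod', ENNReal.tsum_comm]

theorem tsum_support (π : PMF (Fin n → ℝ≥0)) (f : (Fin n → ℝ≥0) → ℝ≥0∞) :
    ∑' v : π.support, π v.1 * f v.1 = ∑' v, π v * f v :=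
  tsum_subtype_eq_of_support_subset (f := fun v => π v * f v) fun _ hv =>
    (PMF.mem_support_iff _ _).2 (left_ne_zero_of_mul hv)

/-- The revenue from offering the best price to buyer `i` given the valuations of the others. -/
noncomputable def condPriceRevenue (π : PMF (Fin n → ℝ≥0)) (i : Fin n) : ℝ≥0∞ :=
  ∑' u, ⨆ t : ℝ≥0, (t : ℝ≥0∞) * ∑' w, if t ≤ w then π (joinAt i w u) else 0

theorem tsum_expPay_le_condPriceRevenue {M : Mechanism π k} (hIC : IsExPostIC M)
    (hIR : IsExPostIR M) (i : Fin n) :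
    ∑' v : π.support, π v.1 * expPay M i (truthful v) ≤ condPriceRevenue π i := by
  classical
  -- The value `0` off the support is harmless: the single-buyer bound constrains only types of
  -- positive weight.
  let pay : (Fin n → ℝ≥0) → ℝ≥0∞ := fun v =>
    if h : v ∈ π.support then expPay M i (truthful ⟨v, h⟩) else 0
  let alloc : (Fin n → ℝ≥0) → ℝ≥0∞ := fun v =>
    if h : v ∈ π.support then expAlloc M i (truthful ⟨v, h⟩) else 0
  have hpay : ∀ v : π.support, expPay M i (truthful v) = pay v.1 := fun v => by
    dsimp only [pay]
    rw [dif_pos v.2]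
  simp_rw [hpay]
  rw [tsum_support, tsum_joinAt i]
  refine ENNReal.tsum_le_tsum fun u => ?_
  refine tsum_mul_pay_le_iSup_price (fun w => π (joinAt i w u)) (fun w => alloc (joinAt i w u))
    (fun w => pay (joinAt i w u)) (fun w => PMF.apply_ne_top _ _) (fun w => ?_) (fun w hw => ?_)
    (fun w w' hw hw' => ?_)
  · dsimp only [alloc]
    split_ifs
    exacts [expAlloc_le_one _ _ _, zero_le_one]
  · have hs : joinAt i w u ∈ π.support := hw
    dsimp only [alloc, pay]
    rw [dif_pos hs, dif_pos hs]
    simpa only [joinAt_self] using hIR.expPay_le i ⟨_, hs⟩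
  · have hs : joinAt i w u ∈ π.support := hw
    have hs' : joinAt i w' u ∈ π.support := hw'
    dsimp only [alloc, pay]
    rw [dif_pos hs, dif_pos hs, dif_pos hs', dif_pos hs']
    have h := hIC i (truthful ⟨_, hs'⟩ i) ⟨_, hs⟩
    rw [update_truthful ⟨_, hs⟩ ⟨_, hs'⟩ i fun j hj => by
        dsimp only
        rw [joinAt_of_ne _ _ _ _ hj, joinAt_of_ne _ _ _ _ hj],
      expUtility_eq_coe _ _ _ _ (hIR.expPay_ne_top i _),
      expUtility_eq_coe _ _ _ _ (hIR.expPay_ne_top i _), EReal.coe_le_coe_iff] at h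
    simpa only [joinAt_self] using h

theorem optRevenue_le_sum (π : PMF (Fin n → ℝ≥0)) (k : ℕ) :
    optRevenue π k ≤ ∑ i, condPriceRevenue π i := by
  refine iSup_le fun M => iSup_le fun hIC => iSup_le fun hIR => ?_
  unfold revenue
  simp_rw [Finset.mul_sum]
  rw [Summable.tsum_finsetSum fun _ _ => ENNReal.summable]
  exact Finset.sum_le_sum fun i _ => tsum_expPay_le_condPriceRevenue hIC hIR i

end

/-! ### Procedures that ask all but one buyer -/

namespace Procedure

variable {n k : ℕ}

/-- Ask the buyers in `l` for their valuations, recording the replies in `r`, and then offer the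
service to buyer `i` at a price that depends on the replies. -/
def askThenOffer (i : Fin n) (P : (Fin n → ℝ≥0) → ℝ≥0) :
    List (Fin n) → (S : Finset (Fin n)) → (Fin n → ℝ≥0) → Procedure n S (k + 1)
  | [], S, r => if h : i ∈ S then offer i h (P r) halt halt else halt
  | j :: l, S, r =>
      if h : j ∈ S then
        ask j h fun a => askThenOffer i P l (S.erase j) (Function.update r j a)
      else halt

/-- The conditions on `l` and `S` keep the run out of the fallback `halt` branches, so the price is
computed from the true replies on `l`. -/
theorem run_askThenOffer (v : Fin n → ℝ≥0) (i : Fin n) (P : (Fin n → ℝ≥0) → ℝ≥0)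
    (l : List (Fin n)) (S : Finset (Fin n)) (r : Fin n → ℝ≥0) (hi : i ∈ S) (hil : i ∉ l)
    (hl : l.Nodup) (hlS : ∀ j ∈ l, j ∈ S) :
    (run v (askThenOffer (k := k) i P l S r)).2 i =
      if P (fun j => if j ∈ l then v j else r j) ≤ v i then
        P (fun j => if j ∈ l then v j else r j) else 0 := by
  induction l generalizing S r with
  | nil =>
    simp only [askThenOffer, hi, dif_pos, run, List.not_mem_nil, if_false]
    split_ifs <;> simp
  | cons j l ih =>
    have hij : i ≠ j := fun h => hil (h ▸ List.mem_cons_self)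
    obtain ⟨hjl, hl'⟩ := List.nodup_cons.1 hl
    have hj : j ∈ S := hlS j List.mem_cons_self
    have hr : (fun m => if m ∈ l then v m else Function.update r j (v j) m) =
        fun m => if m ∈ j :: l then v m else r m := by
      funext m
      by_cases hm : m = j
      · subst hm; simp
      · simp [hm]
    rw [askThenOffer, dif_pos hj, run, ih (S.erase j) _ (Finset.mem_erase.2 ⟨hij, hi⟩)
      (fun h => hil (List.mem_cons_of_mem _ h)) hl' (fun m hm => Finset.mem_erase.2
        ⟨fun h => hjl (h ▸ hm), hlS m (List.mem_cons_of_mem _ hm)⟩), hr]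

/-- Expected revenue of a procedure. -/
noncomputable def expRevenue (π : PMF (Fin n → ℝ≥0)) (T : Procedure n Finset.univ k) : ℝ≥0∞ :=
  ∑' v : π.support, π v.1 * ∑ i, ((run v.1 T).2 i : ℝ≥0∞)

theorem condPriceRevenue_le_iSup (π : PMF (Fin n → ℝ≥0)) (i : Fin n) :
    condPriceRevenue π i ≤ ⨆ T : Procedure n Finset.univ (k + 1), expRevenue π T := by
  refine (tsum_iSup_le_iSup_tsum _).trans (iSup_le fun P => ?_)
  let T : Procedure n Finset.univ (k + 1) :=
    askThenOffer i (fun r => P fun j => r j.1) (Finset.univ.erase i).toList Finset.univ 0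
  have hT : ∀ v, (run v T).2 i = if P (fun j => v j.1) ≤ v i then P (fun j => v j.1) else 0 := by
    intro v
    have hP : (fun j : {j // j ≠ i} =>
        if j.1 ∈ (Finset.univ.erase i).toList then v j.1 else (0 : Fin n → ℝ≥0) j.1) =
        fun j => v j.1 := by
      funext j; simp [j.2]
    have h := run_askThenOffer (k := k) v i (fun r => P fun j => r j.1)
      (Finset.univ.erase i).toList Finset.univ 0 (Finset.mem_univ _) (by simp)
      (Finset.nodup_toList _) (fun _ _ => Finset.mem_univ _)
    simp only [hP] at h
    exact h
  refine le_iSup_of_le T ?_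
  unfold expRevenue
  rw [tsum_support π fun v => ∑ j, ((run v T).2 j : ℝ≥0∞)]
  calc ∑' u, (P u : ℝ≥0∞) * ∑' w, (if P u ≤ w then π (joinAt i w u) else 0)
      = ∑' v, π v * ((run v T).2 i : ℝ≥0∞) := by
        rw [tsum_joinAt i]
        refine tsum_congr fun u => ?_
        rw [← ENNReal.tsum_mul_left]
        refine tsum_congr fun w => ?_
        have hu : (fun j : {j // j ≠ i} => joinAt i w u j.1) = u := by
          funext j; exact joinAt_of_ne i w u j.1 j.2
        rw [hT, hu, joinAt_self]
        split_ifs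
        · exact mul_comm _ _
        · simp
    _ ≤ _ := ENNReal.tsum_le_tsum fun v => by
        gcongr
        exact Finset.single_le_sum (f := fun j => ((run v T).2 j : ℝ≥0∞))
          (fun _ _ => zero_le) (Finset.mem_univ i)

end Procedure

/-! ### Randomizing over procedures -/

section

variable {n k : ℕ}

theorem expPay_map_toMechanism {π : PMF (Fin n → ℝ≥0)} {Ω : Type} [MeasurableSpace Ω]
    (P : ProbabilityMeasure Ω) (T : Ω → Procedure n Finset.univ k)
    (hT : Measurable fun ω => (T ω).toMechanism π) (i : Fin n) (v : π.support) :
    expPay (P.map hT.aemeasurable) i (truthful v) =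
      ∫⁻ ω, ((Procedure.run v.1 (T ω)).2 i : ℝ≥0∞) ∂(P : Measure Ω) := by
  unfold expPay
  rw [ProbabilityMeasure.toMeasure_map, lintegral_map _ hT]
  · rfl
  · exact ((measurable_pi_apply i).comp (measurable_snd.comp (measurable_subtype_coe.comp
      (measurable_pi_apply (truthful v))))).coe_nnreal_ennreal

/-- Drawing the `j`-th procedure of a sequence with probability `2⁻¹ ^ (j + 1)` yields at least
that fraction of its revenue. -/
theorem exists_isEnhancedSPP_mixture (π : PMF (Fin n → ℝ≥0))
    (T : ℕ → Procedure n Finset.univ k) :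
    ∃ M : Mechanism π k, IsEnhancedSPP M ∧
      ∀ j, 2⁻¹ ^ (j + 1) * (T j).expRevenue π ≤ revenue M := by
  let ρ : PMF ℕ := ⟨fun j => 2⁻¹ ^ (j + 1), by
    have h : ∑' j : ℕ, (2⁻¹ : ℝ≥0∞) ^ (j + 1) = 1 := by
      rw [ENNReal.tsum_geometric_add_one, ENNReal.one_sub_inv_two, inv_inv,
        ENNReal.inv_mul_cancel two_ne_zero ENNReal.ofNat_ne_top]
    exact h ▸ ENNReal.summable.hasSum⟩
  have hT : Measurable fun j => (T j).toMechanism π := measurable_from_nat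
  let P : ProbabilityMeasure ℕ := ⟨ρ.toMeasure, inferInstance⟩
  refine ⟨P.map hT.aemeasurable, ⟨ℕ, inferInstance, P, T, hT, rfl⟩, fun j => ?_⟩
  have hpay : ∀ (i : Fin n) (v : π.support),
      2⁻¹ ^ (j + 1) * ((Procedure.run v.1 (T j)).2 i : ℝ≥0∞) ≤
        expPay (P.map hT.aemeasurable) i (truthful v) := by
    intro i v
    rw [expPay_map_toMechanism P T hT, lintegral_countable']
    refine le_trans (le_of_eq ?_) (ENNReal.le_tsum j)
    have : (P : Measure ℕ) {j} = 2⁻¹ ^ (j + 1) :=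
      PMF.toMeasure_apply_singleton ρ j (measurableSet_singleton j)
    rw [this, mul_comm]
  unfold Procedure.expRevenue revenue
  rw [← ENNReal.tsum_mul_left]
  refine ENNReal.tsum_le_tsum fun v => ?_
  rw [mul_left_comm, Finset.mul_sum]
  gcongr
  exact hpay _ v

theorem exists_isEnhancedSPP_iSup_le (π : PMF (Fin n → ℝ≥0)) :
    ∃ M : Mechanism π k, IsEnhancedSPP M ∧
      4⁻¹ * (⨆ T : Procedure n Finset.univ k, T.expRevenue π) ≤ revenue M := by
  set R := ⨆ T : Procedure n Finset.univ k, T.expRevenue π with hR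
  have hlt : ∀ a < R, ∃ T : Procedure n Finset.univ k, a < T.expRevenue π := fun a ha =>
    lt_iSup_iff.1 ha
  rcases eq_or_ne R ⊤ with htop | htop
  -- The factor `2 ^ (j + 1)` cancels the probability of the `j`-th procedure, which thus
  -- contributes at least `j` for every `j`.
  · have hj : ∀ j : ℕ, ∃ T : Procedure n Finset.univ k,
        2 ^ (j + 1) * (j : ℝ≥0∞) < T.expRevenue π := fun j =>
      hlt _ (htop ▸ (ENNReal.mul_ne_top (by finiteness) (by finiteness)).lt_top)
    choose T hT using hj
    obtain ⟨M, hM, hrev⟩ := exists_isEnhancedSPP_mixture π T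
    refine ⟨M, hM, ?_⟩
    have : revenue M = ⊤ := by
      refine ENNReal.eq_top_of_forall_nnreal_le fun r => ?_
      obtain ⟨j, hj⟩ := exists_nat_ge r
      calc (r : ℝ≥0∞) ≤ j := by exact_mod_cast hj
        _ = 2⁻¹ ^ (j + 1) * (2 ^ (j + 1) * (j : ℝ≥0∞)) := by
            rw [← mul_assoc, ← mul_pow, ENNReal.inv_mul_cancel two_ne_zero ENNReal.ofNat_ne_top,
              one_pow, one_mul]
        _ ≤ 2⁻¹ ^ (j + 1) * (T j).expRevenue π := by gcongr; exact (hT j).le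
        _ ≤ revenue M := hrev j
    rw [this]; exact le_top
  · have hex : ∃ T : Procedure n Finset.univ k, R / 2 ≤ T.expRevenue π := by
      rcases eq_or_ne R 0 with h0 | h0
      · exact ⟨.halt, by simp [h0]⟩
      · obtain ⟨T, hT⟩ := hlt _ (ENNReal.half_lt_self h0 htop)
        exact ⟨T, hT.le⟩
    obtain ⟨T, hT⟩ := hex
    obtain ⟨M, hM, hrev⟩ := exists_isEnhancedSPP_mixture π fun _ => T
    refine ⟨M, hM, le_trans ?_ (hrev 0)⟩
    have h4 : (4⁻¹ : ℝ≥0∞) = 2⁻¹ * 2⁻¹ := by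
      rw [← ENNReal.mul_inv (by simp) (by simp)]; norm_num
    rw [h4, mul_assoc, zero_add, pow_one]
    gcongr
    rwa [mul_comm, ← div_eq_mul_inv]

end

end Auction

theorem mainTheorem6 :
    ∃ c : ℝ≥0, 0 < c ∧
      ∀ (n k : ℕ), 1 ≤ n → 1 ≤ k → ∀ π : PMF (Fin n → ℝ≥0),
        ∃ M : Auction.Mechanism π k, Auction.IsEnhancedSPP M ∧
          (c : ℝ≥0∞) / (n : ℝ≥0∞) * Auction.optRevenue π k ≤ Auction.revenue M := by
  refine ⟨4⁻¹, by norm_num, fun n k hn hk π => ?_⟩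
  -- Positive supply is what makes the single offer possible.
  obtain ⟨k, rfl⟩ := Nat.exists_eq_add_of_le' hk
  obtain ⟨M, hM, hrev⟩ := Auction.exists_isEnhancedSPP_iSup_le (k := k + 1) π
  refine ⟨M, hM, le_trans ?_ hrev⟩
  have hopt : Auction.optRevenue π (k + 1) ≤
      n * ⨆ T : Auction.Procedure n Finset.univ (k + 1), T.expRevenue π := by
    refine (Auction.optRevenue_le_sum π _).trans ((Finset.sum_le_sum fun i _ =>
      Auction.Procedure.condPriceRevenue_le_iSup (k := k) π i).trans (le_of_eq ?_))
    rw [Finset.sum_const, Finset.card_univ, Fintype.card_fin, nsmul_eq_mul]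
  have hn0 : (n : ℝ≥0∞) ≠ 0 := by exact_mod_cast (by omega : n ≠ 0)
  calc ((4⁻¹ : ℝ≥0) : ℝ≥0∞) / n * Auction.optRevenue π (k + 1)
      ≤ ((4⁻¹ : ℝ≥0) : ℝ≥0∞) / n *
        (n * ⨆ T : Auction.Procedure n Finset.univ (k + 1), T.expRevenue π) := by gcongr
    _ = 4⁻¹ * ⨆ T : Auction.Procedure n Finset.univ (k + 1), T.expRevenue π := by
        rw [← mul_assoc, ENNReal.div_mul_cancel hn0 (ENNReal.natCast_ne_top n),
          ENNReal.coe_inv (by norm_num)]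
        norm_num
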